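/- Let $n,s,d$ be integers with $0\le s\le n$ and $d\ge 2$. Let $q_0=n+1$, let $q_1<q_2<\cdots$ be the prime numbers greater than $n+1$ in increasing order, and let $a_{ij}=\frac{1}{q_i-j}$ for $i\ge 0$, $0\le j\le n$ (a Cauchy matrix). Let $T_d$ be the Chebyshev polynomial (of the first kind) of degree $d$, and put $$\tilde g(x)=\sum_{j=1}^n a_{0j}T_d(x_j),\qquad \tilde f_i(x)=a_{i0}+\sum_{j=1}^n a_{ij}\bigl(T_d(x_j)+1\bigr)\quad(1\le i\le s),$$ $$\tilde g_j(x,\lambda)=\lambda_0\frac{\partial\tilde g}{\partial x_j}-\sum_{i=1}^s\lambda_i\frac{\partial\tilde f_i}{\partial x_j}\quad(1\le j\le n).$$ Let $W\subset\mathbb A^n\times\mathbb P^s$ (over $\mathbb C$, with homogeneous coordinates $\lambda_0,\dots,\lambda_s$ on $\mathbb P^s$) be the set of common zeros of $\tilde f_1,\dots,\tilde f_s,\tilde g_1,\dots,\tilde g_n$. Then: 1. $W\subset\mathbb A^n\times\{\lambda_0\ne 0\}$, and $W$ is zero-dimensional: it is finite, with exactly $D_s=\binom ns d^s(d-1)^{n-s}\geq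 1$ points. 2. Distinct points of $W$ have distinct projections to $\mathbb A^n$. 3. At each point of $W$, in the affine coordinates $(x_1,\dots,x_n,\lambda_1,\dots,\lambda_s)$ with $\lambda_0=1$, the Jacobian determinant, with respect to $x_1,\dots,x_n,\lambda_1,\dots,\lambda_s$, of $\tilde f_1,\dots,\tilde f_s$ and of the polynomials obtained from $\tilde g_1,\dots,\tilde g_n$ by setting $\lambda_0=1$ is nonzero. -/

import Mathlib

namespace StartSystem

open MvPolynomial

noncomputable section

/-- `q n 0 = n + 1`, and `q n 1 < q n 2 < ⋯` are the prime numbers greater than `n + 1`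
in increasing order. -/
def q (n : ℕ) : ℕ → ℕ
  | 0 => n + 1
  | i + 1 => Nat.nth (fun p => p.Prime ∧ n + 1 < p) i

/-- The entries of the Cauchy matrix, `a i j = 1 / (q_i - j)` for `0 ≤ j ≤ n`. -/
def a (n i j : ℕ) : ℚ := 1 / ((q n i : ℚ) - (j : ℚ))

/-- The Chebyshev polynomial (of the first kind) of degree `d` in the variable `x_j`. The index
`j : Fin n` stands for the variable number `j + 1`. -/
def chebyshevX (n d : ℕ) (j : Fin n) : MvPolynomial (Fin n) ℚ :=
  Polynomial.aeval (X j) (Polynomial.Chebyshev.T ℚ (d : ℤ))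

/-- `g̃ = ∑_{1 ≤ j ≤ n} a_{0j} T_d(x_j)`. -/
def gTilde (n d : ℕ) : MvPolynomial (Fin n) ℚ :=
  ∑ j : Fin n, C (a n 0 (j + 1)) * chebyshevX n d j

/-- `f̃_i = a_{i0} + ∑_{1 ≤ j ≤ n} a_{ij} (T_d(x_j) + 1)`, for `i ≥ 1`. -/
def fTilde (n d i : ℕ) : MvPolynomial (Fin n) ℚ :=
  C (a n i 0) + ∑ j : Fin n, C (a n i (j + 1)) * (chebyshevX n d j + 1)

/-- `g̃_j = λ_0 ∂g̃/∂x_j - ∑_{1 ≤ i ≤ s} λ_i ∂f̃_i/∂x_j`, a polynomial in `x_1, …, x_n` (variables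
`Sum.inl _`) and `λ_0, …, λ_s` (variables `Sum.inr _`). -/
def gTildeJ (n d s : ℕ) (j : Fin n) : MvPolynomial (Fin n ⊕ Fin (s + 1)) ℚ :=
  X (Sum.inr 0) * rename Sum.inl (pderiv j (gTilde n d)) -
    ∑ i : Fin s, X (Sum.inr i.succ) * rename Sum.inl (pderiv j (fTilde n d (i + 1)))

/-- The common zeros of `f̃_1, …, f̃_s, g̃_1, …, g̃_n` in `𝔸ⁿ × ℙˢ` over `ℂ`. The `g̃_j` are
homogeneous in `λ`, so the choice of homogeneous coordinates is irrelevant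
(see `mk_mem_startVariety`). -/
def startVariety (n d s : ℕ) :
    Set ((Fin n → ℂ) × Projectivization ℂ (Fin (s + 1) → ℂ)) :=
  {w | (∀ i : Fin s, aeval w.1 (fTilde n d (i + 1)) = 0) ∧
    ∀ j : Fin n, aeval (Sum.elim w.1 w.2.rep) (gTildeJ n d s j) = 0}

/-- The open subset `{λ_0 ≠ 0}` of `ℙˢ`. -/
def chart (s : ℕ) : Set (Projectivization ℂ (Fin (s + 1) → ℂ)) :=
  {L | L.rep 0 ≠ 0}

/-- The coordinates `(λ_1 / λ_0, …, λ_s / λ_0)` of a point of `{λ_0 ≠ 0} ⊆ ℙˢ`. -/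
def affineCoord {s : ℕ} (L : Projectivization ℂ (Fin (s + 1) → ℂ)) : Fin s → ℂ :=
  fun i => L.rep i.succ / L.rep 0

/-- Dehomogenization `λ_0 = 1`. -/
def dehomogenize {n s : ℕ} (p : MvPolynomial (Fin n ⊕ Fin (s + 1)) ℚ) :
    MvPolynomial (Fin n ⊕ Fin s) ℚ :=
  aeval (Sum.elim (fun j => X (Sum.inl j)) (Fin.cons 1 fun i => X (Sum.inr i)) :
    Fin n ⊕ Fin (s + 1) → MvPolynomial (Fin n ⊕ Fin s) ℚ) p

/-- The `n + s` polynomials `g̃_1, …, g̃_n` (with `λ_0 = 1`) and `f̃_1, …, f̃_s` in the `n + s`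
variables `x_1, …, x_n, λ_1, …, λ_s`. -/
def affineSystem (n d s : ℕ) : Fin n ⊕ Fin s → MvPolynomial (Fin n ⊕ Fin s) ℚ :=
  Sum.elim (fun j => dehomogenize (gTildeJ n d s j))
    (fun i => rename Sum.inl (fTilde n d (i + 1)))

/-- The Jacobian determinant of the dehomogenized system with respect to
`x_1, …, x_n, λ_1, …, λ_s` (the order of the polynomials affects it only by a sign). -/
def jacobianDet (n d s : ℕ) : MvPolynomial (Fin n ⊕ Fin s) ℚ :=
  (Matrix.of fun r c : Fin n ⊕ Fin s => pderiv c (affineSystem n d s r)).det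

theorem aeval_gTildeJ (n d s : ℕ) (j : Fin n) (x : Fin n → ℂ) (v : Fin (s + 1) → ℂ) :
    aeval (Sum.elim x v) (gTildeJ n d s j) =
      v 0 * aeval x (pderiv j (gTilde n d)) -
        ∑ i : Fin s, v i.succ * aeval x (pderiv j (fTilde n d (i + 1))) := by
  simp [gTildeJ, aeval_rename, Sum.elim_comp_inl]

/-- Membership in `startVariety` may be tested on any homogeneous coordinates. -/
theorem mk_mem_startVariety (n d s : ℕ) (x : Fin n → ℂ) (v : Fin (s + 1) → ℂ) (hv : v ≠ 0) :
    (x, Projectivization.mk ℂ v hv) ∈ startVariety n d s ↔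
      (∀ i : Fin s, aeval x (fTilde n d (i + 1)) = 0) ∧
        ∀ j : Fin n, aeval (Sum.elim x v) (gTildeJ n d s j) = 0 := by
  obtain ⟨c, hc⟩ := Projectivization.exists_smul_eq_mk_rep ℂ v hv
  have h : ∀ j : Fin n, aeval (Sum.elim x (Projectivization.mk ℂ v hv).rep) (gTildeJ n d s j) =
      (c : ℂ) * aeval (Sum.elim x v) (gTildeJ n d s j) := by
    intro j
    rw [aeval_gTildeJ, aeval_gTildeJ, ← hc, mul_sub, Finset.mul_sum]
    simp [Units.smul_def, mul_assoc]
  simp [startVariety, h]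

end

end StartSystem

/-! By the chain rule each `g̃_j` factors as `T_d'(x_j)` times the linear form `λ_0 a_{0j} - ∑ λ_i
a_{ij}`, while the `f̃_i` are affine in `y_j = T_d(x_j) + 1`. So at a point of `W` each index is
either critical (`T_d'(x_j) = 0`, whence `y_j ∈ {0, 2}`) or its linear form vanishes. Cauchy
independence lets at most `s` of these forms vanish at a nonzero `λ`. The arithmetic input is
`exists_row_ne_zero`: with only `t` free indices, `t + 1` of the affine equations are inconsistent.
It is proved by reduction modulo `q_{t+1}`. Hence exactly `s` indices are noncritical; then `λ` is
unique up to scaling with `λ_0 ≠ 0`, and the Jacobian is invertible by nondegeneracy of the critical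
points and Cauchy independence. For the count, choose the `s` noncritical indices and one of `d - 1`
critical points at each other index. The Cauchy system determines the remaining `y_j`; the same
arithmetic lemma excludes `0` and `2`, so each has `d` preimages. -/

namespace StartSystem

open MvPolynomial

noncomputable section

/-! ### Cauchy matrices and the nodes `q_i` -/

/-- Any family of at most `#I` columns of a Cauchy matrix with row set `I` is linearly
independent. -/
theorem cauchy_coeff_eq_zero {K ι κ : Type*} [Field K] [DecidableEq κ] {I : Finset ι}
    {J : Finset κ} {x : ι → K} {y : κ → K} (hx : Set.InjOn x I) (hy : Set.InjOn y J)
    (hxy : ∀ i ∈ I, ∀ j ∈ J, x i ≠ y j) (hcard : J.card ≤ I.card) {c : κ → K}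
    (h : ∀ i ∈ I, ∑ j ∈ J, c j / (x i - y j) = 0) : ∀ j ∈ J, c j = 0 := by
  -- `P` is the numerator of `∑ c_j / (X - y_j)`: its degree is below `#J ≤ #I`, it vanishes at
  -- every `x_i`, and its value at `y_j` isolates `c_j`.
  let P : Polynomial K :=
    ∑ j ∈ J, Polynomial.C (c j) * ∏ k ∈ J.erase j, (Polynomial.X - Polynomial.C (y k))
  have hP : P = 0 := by
    rcases J.eq_empty_or_nonempty with rfl | hJ
    · simp [P]
    refine Polynomial.eq_zero_of_degree_lt_of_eval_index_eq_zero (v := x) (s := I) hx ?_ ?_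
    · refine lt_of_lt_of_le ?_ (Nat.cast_le.mpr hcard)
      refine (Polynomial.degree_sum_le _ _).trans_lt ?_
      rw [Finset.sup_lt_iff (WithBot.bot_lt_coe _)]
      intro j hj
      refine lt_of_le_of_lt (Polynomial.degree_mul_le _ _) ?_
      refine lt_of_le_of_lt (add_le_add_left Polynomial.degree_C_le _) ?_
      rw [zero_add, Polynomial.degree_prod]
      simp only [Polynomial.degree_X_sub_C, Finset.sum_const, nsmul_eq_mul, mul_one]
      exact_mod_cast Finset.card_erase_lt_of_mem hj
    · intro i hi
      have key : P.eval (x i) =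
          (∏ k ∈ J, (x i - y k)) * ∑ j ∈ J, c j / (x i - y j) := by
        simp only [P, Polynomial.eval_finsetSum, Polynomial.eval_mul, Polynomial.eval_C,
          Polynomial.eval_prod, Polynomial.eval_sub, Polynomial.eval_X, Finset.mul_sum]
        refine Finset.sum_congr rfl fun j hj => ?_
        have : x i - y j ≠ 0 := sub_ne_zero.mpr (hxy i hi j hj)
        rw [← Finset.mul_prod_erase J _ hj]
        field_simp
      rw [key, h i hi, mul_zero]
  intro j hj
  have h0 : P.eval (y j) = c j * ∏ k ∈ J.erase j, (y j - y k) := by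
    simp only [P, Polynomial.eval_finsetSum, Polynomial.eval_mul, Polynomial.eval_C,
      Polynomial.eval_prod, Polynomial.eval_sub, Polynomial.eval_X]
    refine Finset.sum_eq_single_of_mem j hj fun k hk hkj => ?_
    rw [Finset.prod_eq_zero (Finset.mem_erase.mpr ⟨hkj.symm, hj⟩) (sub_self _), mul_zero]
  rw [hP, Polynomial.eval_zero] at h0
  refine (mul_eq_zero.mp h0.symm).resolve_right (Finset.prod_ne_zero_iff.mpr fun k hk => ?_)
  rw [Finset.mem_erase] at hk
  exact sub_ne_zero.mpr fun e => hk.1 (hy hk.2 hj e.symm)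

theorem infinite_primes_gt (n : ℕ) :
    (Set.ofPred fun p : ℕ => p.Prime ∧ n + 1 < p).Infinite := by
  rw [Set.infinite_iff_exists_gt]
  intro m
  obtain ⟨p, hp, hprime⟩ := Nat.exists_infinite_primes (m + n + 2)
  exact ⟨p, ⟨hprime, by omega⟩, by omega⟩

theorem q_succ_spec (n i : ℕ) : (q n (i + 1)).Prime ∧ n + 1 < q n (i + 1) :=
  Nat.nth_mem_of_infinite (infinite_primes_gt n) i

theorem q_strictMono (n : ℕ) : StrictMono (q n) := by
  refine strictMono_nat_of_lt_succ fun i => ?_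
  cases i with
  | zero => exact (q_succ_spec n 0).2
  | succ i => exact Nat.nth_strictMono (infinite_primes_gt n) i.lt_succ_self

theorem lt_q (n i : ℕ) : n < q n i :=
  Nat.lt_of_succ_le ((q_strictMono n).monotone i.zero_le)

theorem coe_a (n i j : ℕ) : ((a n i j : ℚ) : ℂ) = 1 / ((q n i : ℂ) - (j : ℂ)) := by
  simp [a]

/-- A vanishing combination of at most `#I` columns of `a`, restricted to the rows indexed by `I`, is
trivial. -/
theorem a_columns_independent {n : ℕ} {ι : Type*} {I : Finset ι} {r : ι → ℕ}
    (hr : Set.InjOn r I) {J : Finset (Fin n)}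
    (hcard : J.card ≤ I.card) {c : Fin n → ℂ}
    (h : ∀ i ∈ I, ∑ j ∈ J, (a n (r i) (j + 1) : ℂ) * c j = 0) : ∀ j ∈ J, c j = 0 := by
  refine cauchy_coeff_eq_zero (I := I) (x := fun i => (q n (r i) : ℂ))
    (y := fun j : Fin n => (((j : ℕ) + 1 : ℕ) : ℂ)) ?_ ?_ ?_ hcard ?_
  · intro i hi k hk hik
    exact hr hi hk ((q_strictMono n).injective (Nat.cast_injective hik))
  · intro j _ k _ hjk
    have := Nat.cast_injective hjk
    exact Fin.ext (by omega)
  · intro i _ j _ hij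
    have := Nat.cast_injective hij
    have := lt_q n (r i)
    omega
  · intro i hi
    rw [← h i hi]
    refine Finset.sum_congr rfl fun j _ => ?_
    rw [coe_a]
    ring

/-- A vanishing combination of at most `#J` rows of `a`, restricted to the columns in `J`, is
trivial. -/
theorem a_rows_independent {n : ℕ} {ι : Type*} [DecidableEq ι] {I : Finset ι}
    {r : ι → ℕ} (hr : Set.InjOn r I) {J : Finset (Fin n)}
    (hcard : I.card ≤ J.card) {c : ι → ℂ}
    (h : ∀ j ∈ J, ∑ i ∈ I, (a n (r i) (j + 1) : ℂ) * c i = 0) : ∀ i ∈ I, c i = 0 := by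
  refine cauchy_coeff_eq_zero (I := J) (y := fun i => (q n (r i) : ℂ))
    (x := fun j : Fin n => (((j : ℕ) + 1 : ℕ) : ℂ)) ?_ ?_ ?_ hcard ?_
  · intro j _ k _ hjk
    have := Nat.cast_injective hjk
    exact Fin.ext (by omega)
  · intro i hi k hk hik
    exact hr hi hk ((q_strictMono n).injective (Nat.cast_injective hik))
  · intro j _ i _ hij
    have := Nat.cast_injective hij
    have := lt_q n (r i)
    omega
  · intro j hj
    rw [← neg_eq_zero, ← Finset.sum_neg_distrib, ← h j hj]
    refine Finset.sum_congr rfl fun i _ => ?_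
    rw [coe_a, ← neg_sub ((q n (r i) : ℕ) : ℂ), div_neg, neg_neg]
    ring

/-! ### Inconsistency by reduction modulo a prime -/

/-- If an integer matrix has a nonzero kernel vector in characteristic zero, then it has one
over every field. -/
theorem exists_mulVec_eq_zero_of_int {ι K : Type*} [Fintype ι] [DecidableEq ι] [Field K]
    (M : Matrix ι ι ℤ) {c : ι → ℂ} (hc : c ≠ 0)
    (h : (M.map (Int.castRingHom ℂ)).mulVec c = 0) :
    ∃ v : ι → K, v ≠ 0 ∧ (M.map (Int.castRingHom K)).mulVec v = 0 := by
  have h0 : (M.map (Int.castRingHom ℂ)).det = 0 :=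
    Matrix.exists_mulVec_eq_zero_iff.mp ⟨c, hc, h⟩
  rw [← RingHom.mapMatrix_apply, ← RingHom.map_det] at h0
  have h1 : M.det = 0 := by simpa using h0
  refine Matrix.exists_mulVec_eq_zero_iff.mpr ?_
  rw [← RingHom.mapMatrix_apply, ← RingHom.map_det, h1, map_zero]

/-- The entries of the Cauchy matrix, with the denominators cleared in each row. -/
def intCauchy (n i j : ℕ) : ℤ :=
  ∏ k ∈ (Finset.range (n + 1)).erase j, ((q n i : ℤ) - (k : ℤ))

theorem intCauchy_cast {K : Type*} [Field K] {n i j : ℕ} (hj : j ≤ n)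
    (h : (q n i : K) ≠ (j : K)) :
    (intCauchy n i j : K) =
      (∏ k ∈ Finset.range (n + 1), ((q n i : K) - (k : K))) * (1 / ((q n i : K) - (j : K))) := by
  rw [← Finset.mul_prod_erase _ _ (Finset.mem_range.mpr (Nat.lt_succ_of_le hj))]
  have : (q n i : K) - j ≠ 0 := sub_ne_zero.mpr h
  simp only [intCauchy, Int.cast_prod, Int.cast_sub, Int.cast_natCast]
  field_simp

theorem natCast_zmod_injOn (p : ℕ) : Set.InjOn (fun k : ℕ => (k : ZMod p)) (Set.Iio p) := by
  intro x hx y hy h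
  exact ((ZMod.natCast_eq_natCast_iff x y p).mp h).eq_of_lt_of_lt hx hy

/-- If `y_j ∈ {0, 2}` for all but `t` indices `j`, then the equations
`a_{i0} + ∑ a_{ij} y_j = 0` do not all hold for `1 ≤ i ≤ t + 1`. -/
theorem exists_row_ne_zero {n : ℕ} (J : Finset (Fin n)) (y : Fin n → ℂ)
    (hy : ∀ j ∉ J, y j = 0 ∨ y j = 2) :
    ∃ i < J.card + 1, (a n (i + 1) 0 : ℂ) + ∑ j : Fin n, (a n (i + 1) (j + 1) : ℂ) * y j ≠ 0 := by
  by_contra! hcon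
  obtain ⟨t, ht⟩ : ∃ t, J.card = t := ⟨_, rfl⟩
  rw [ht] at hcon
  let e : Fin t ≃ J := (J.equivFinOfCardEq ht).symm
  -- The last node used: it divides a denominator only in row `t + 1`, column `0` excepted after
  -- clearing, and exceeds all earlier nodes.
  let p := q n (t + 1)
  have hp : p.Prime := (q_succ_spec n t).1
  have hpn : n + 1 < p := (q_succ_spec n t).2
  have : Fact p.Prime := ⟨hp⟩
  have hz : ∀ j, ∃ z : ℤ, j ∉ J → (z : ℂ) = y j := by
    intro j
    by_cases hj : j ∈ J
    · exact ⟨0, fun h => absurd hj h⟩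
    · rcases hy j hj with h | h
      · exact ⟨0, fun _ => by simp [h]⟩
      · exact ⟨2, fun _ => by simp [h]⟩
  choose z hz using hz
  -- The constant column and the prescribed `y_j` are merged into one integer column, so `M` is
  -- square and `(1, y_j)` with `j ∈ J` lies in its kernel.
  let b : ℕ → ℤ := fun i => intCauchy n i 0 +
    ∑ j ∈ Finset.univ.filter (· ∉ J), intCauchy n i ((j : ℕ) + 1) * z j
  let M : Matrix (Fin (t + 1)) (Fin (t + 1)) ℤ := Matrix.of fun i =>
    Fin.cons (b (i + 1)) fun l : Fin t => intCauchy n (i + 1) (((e l : Fin n) : ℕ) + 1)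
  have hsplit : ∀ F : Fin n → ℂ, ∑ j, F j =
      ∑ j ∈ Finset.univ.filter (· ∉ J), F j + ∑ l : Fin t, F (e l) := by
    intro F
    rw [← Finset.sum_filter_not_add_sum_filter Finset.univ (· ∈ J) F]
    congr 1
    rw [Equiv.sum_comp e (fun j : J => F j), Finset.sum_coe_sort J F]
    exact Finset.sum_congr (by ext; simp) fun _ _ => rfl
  have hker : (M.map (Int.castRingHom ℂ)).mulVec
      (Fin.cons 1 fun l : Fin t => y (e l)) = 0 := by
    ext i
    have hne : ∀ j ≤ n, ((q n (i + 1) : ℕ) : ℂ) ≠ (j : ℂ) := by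
      intro j hj hij
      have := Nat.cast_injective hij
      have := lt_q n (i + 1)
      omega
    have hrow := hcon i i.2
    rw [hsplit] at hrow
    simp only [Matrix.mulVec, dotProduct, Fin.sum_univ_succ, Matrix.map_apply, M, Matrix.of_apply,
      Fin.cons_zero, Fin.cons_succ, Pi.zero_apply, b, eq_intCast, Int.cast_add, Int.cast_sum,
      Int.cast_mul, mul_one]
    rw [intCauchy_cast n.zero_le (hne 0 n.zero_le)]
    have e1 : ∀ j : Fin n, (intCauchy n (i + 1) ((j : ℕ) + 1) : ℂ) =
        (∏ k ∈ Finset.range (n + 1), ((q n (i + 1) : ℂ) - (k : ℂ))) * (a n (i + 1) (j + 1) : ℂ) := by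
      intro j
      rw [intCauchy_cast (by omega) (hne _ (by omega)), coe_a]
    rw [← coe_a]
    simp only [e1]
    have e2 : ∀ j ∈ Finset.univ.filter (· ∉ J), (z j : ℂ) = y j := fun j hj =>
      hz j (Finset.mem_filter.mp hj).2
    rw [Finset.sum_congr rfl fun j hj => by rw [e2 j hj]]
    simp only [mul_assoc, ← Finset.mul_sum, ← mul_add]
    rw [← add_assoc] at hrow
    rw [hrow, mul_zero]
  obtain ⟨v, hv0, hv⟩ := exists_mulVec_eq_zero_of_int (K := ZMod p) M
    (fun h => one_ne_zero (congrFun h 0)) hker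
  have hrow : ∀ i : Fin (t + 1), (b (i + 1) : ZMod p) * v 0 +
      ∑ l : Fin t, (intCauchy n (i + 1) (((e l : Fin n) : ℕ) + 1) : ZMod p) * v l.succ = 0 := by
    intro i
    have := congrFun hv i
    simpa [Matrix.mulVec, dotProduct, Fin.sum_univ_succ, M] using this
  -- Columns `j ≥ 1` keep the factor `q_{t+1} - 0`, which is zero modulo `p`. Column `0` omits it,
  -- leaving factors `-k` with `1 ≤ k ≤ n < p`. The last row therefore forces `v 0 = 0`.
  have hlast : ∀ j : Fin n, (intCauchy n (t + 1) ((j : ℕ) + 1) : ZMod p) = 0 := by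
    intro j
    simp only [intCauchy, Int.cast_prod, Int.cast_sub, Int.cast_natCast]
    refine Finset.prod_eq_zero (i := 0) (by simp) ?_
    simp [p]
  have hlast0 : (intCauchy n (t + 1) 0 : ZMod p) ≠ 0 := by
    simp only [intCauchy, Int.cast_prod, Int.cast_sub, Int.cast_natCast]
    refine Finset.prod_ne_zero_iff.mpr fun k hk => ?_
    simp only [Finset.mem_erase, Finset.mem_range] at hk
    have hqp : ((q n (t + 1) : ℕ) : ZMod p) = 0 := by simp [p]
    rw [hqp, zero_sub, neg_ne_zero]
    intro hk0
    have := natCast_zmod_injOn p (Set.mem_Iio.mpr (by omega : k < p))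
      (Set.mem_Iio.mpr hp.pos) (by simpa using hk0)
    exact hk.1 this
  have hv_zero : v 0 = 0 := by
    have := hrow (Fin.last t)
    simp only [Fin.val_last, hlast, zero_mul, Finset.sum_const_zero, add_zero, b, Int.cast_add,
      Int.cast_sum, Int.cast_mul] at this
    exact (mul_eq_zero.mp this).resolve_left hlast0
  have hql : ∀ i < t, q n (i + 1) < p := fun i hi => q_strictMono n (by omega)
  -- The first `t` rows are now a rescaled Cauchy system modulo `p`; its nodes stay distinct because
  -- all of them are less than `p`.
  have hv_succ : ∀ l ∈ (Finset.univ : Finset (Fin t)), v l.succ = 0 := by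
    refine cauchy_coeff_eq_zero (I := (Finset.univ : Finset (Fin t)))
      (x := fun i : Fin t => ((q n (i + 1) : ℕ) : ZMod p))
      (y := fun l => ((((e l : Fin n) : ℕ) + 1 : ℕ) : ZMod p)) ?_ ?_ ?_ le_rfl ?_
    · intro i _ k _ hik
      have := natCast_zmod_injOn p (hql i i.2) (hql k k.2) hik
      have := (q_strictMono n).injective this
      exact Fin.ext (by omega)
    · intro l _ m _ hlm
      have := natCast_zmod_injOn p (Set.mem_Iio.mpr (by omega)) (Set.mem_Iio.mpr (by omega)) hlm
      exact e.injective (Subtype.ext (Fin.ext (by simpa using this)))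
    · intro i _ l _ hil
      have := natCast_zmod_injOn p (hql i i.2) (Set.mem_Iio.mpr (by omega)) hil
      have := lt_q n (i + 1)
      omega
    · intro i _
      have hi := hrow i.castSucc
      rw [hv_zero, mul_zero, zero_add] at hi
      have hne : ∀ j ≤ n, ((q n (i + 1) : ℕ) : ZMod p) ≠ (j : ZMod p) := by
        intro j hj hij
        have := natCast_zmod_injOn p (hql i i.2) (Set.mem_Iio.mpr (by omega)) hij
        have := lt_q n (i + 1)
        omega
      have e1 : ∀ l : Fin t, (intCauchy n ((i.castSucc : ℕ) + 1) (((e l : Fin n) : ℕ) + 1) :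
          ZMod p) * v l.succ = (∏ k ∈ Finset.range (n + 1), ((q n (i + 1) : ZMod p) - (k : ZMod p))) *
            (v l.succ / ((q n (i + 1) : ZMod p) - ((((e l : Fin n) : ℕ) + 1 : ℕ) : ZMod p))) := by
        intro l
        rw [Fin.val_castSucc, intCauchy_cast (by omega) (hne _ (by omega))]
        ring
      simp only [e1, ← Finset.mul_sum] at hi
      refine (mul_eq_zero.mp hi).resolve_left (Finset.prod_ne_zero_iff.mpr fun k hk => ?_)
      exact sub_ne_zero.mpr (hne k (by simpa [Nat.lt_succ_iff] using hk))
  refine hv0 (funext fun l => ?_)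
  refine Fin.cases hv_zero (fun l => hv_succ l (Finset.mem_univ l)) l

/-! ### Critical points and fibres of `T_d` -/

/-- The value of the Chebyshev polynomial at a critical point is `±1`. -/
theorem eval_T_of_derivative_eq_zero {d : ℕ} (hd : d ≠ 0) {x : ℂ}
    (h : (Polynomial.Chebyshev.T ℂ d).derivative.eval x = 0) :
    (Polynomial.Chebyshev.T ℂ d).eval x = -1 ∨ (Polynomial.Chebyshev.T ℂ d).eval x = 1 := by
  obtain ⟨θ, rfl⟩ := Complex.cos_surjective x
  rw [Polynomial.Chebyshev.T_derivative_eq_U] at h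
  have hU : (Polynomial.Chebyshev.U ℂ ((d : ℤ) - 1)).eval (Complex.cos θ) = 0 := by
    simpa [hd] using h
  have hsin := Polynomial.Chebyshev.U_complex_cos θ ((d : ℤ) - 1)
  rw [hU, zero_mul] at hsin
  have hT := Polynomial.Chebyshev.T_complex_cos θ (d : ℤ)
  have hsin' : Complex.sin (((d : ℤ) : ℂ) * θ) = 0 := by
    rw [hsin]; push_cast; ring_nf
  have := Complex.sin_sq_add_cos_sq (((d : ℤ) : ℂ) * θ)
  rw [hsin', ← hT] at this
  have : ((Polynomial.Chebyshev.T ℂ d).eval (Complex.cos θ)) ^ 2 = 1 := by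
    linear_combination this
  exact (sq_eq_sq_iff_eq_or_eq_neg.mp (this.trans (one_pow 2).symm)).symm

/-- The critical points of the Chebyshev polynomial are nondegenerate. -/
theorem eval_derivative_derivative_T_ne_zero {d : ℕ} (hd : d ≠ 0) {x : ℂ}
    (h : (Polynomial.Chebyshev.T ℂ d).derivative.eval x = 0) :
    (Polynomial.Chebyshev.T ℂ d).derivative.derivative.eval x ≠ 0 := by
  intro h2
  -- The Chebyshev equation `(1 - x²)T'' = xT' - d²T` would give `d²T(x) = 0`, contradicting `T(x) =
  -- ±1`.
  have hode := congrArg (Polynomial.eval x)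
    (Polynomial.Chebyshev.one_sub_X_sq_mul_derivative_derivative_T_eq_poly_in_T (R := ℂ) d)
  simp only [Function.iterate_succ, Function.iterate_zero, Function.comp_apply, id,
    Polynomial.eval_mul, Polynomial.eval_sub, h, h2, mul_zero, zero_sub] at hode
  rcases eval_T_of_derivative_eq_zero hd h with hT | hT
  · rw [hT] at hode
    simp at hode
    exact hd (by simpa using hode.symm)
  · rw [hT] at hode
    simp at hode
    exact hd hode

/-- A complex polynomial with simple roots has as many roots as its degree. -/
theorem card_toFinset_roots_of_simple {p : Polynomial ℂ} (hp : p ≠ 0)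
    (h : ∀ x, p.eval x = 0 → p.derivative.eval x ≠ 0) :
    p.roots.toFinset.card = p.natDegree := by
  rw [Multiset.toFinset_card_of_nodup, IsAlgClosed.card_roots_eq_natDegree]
  rw [Multiset.nodup_iff_count_le_one]
  intro x
  rw [Polynomial.count_roots]
  by_contra hx
  obtain ⟨h0, h1⟩ := (Polynomial.one_lt_rootMultiplicity_iff_isRoot hp).mp (not_le.mp hx)
  exact h x h0 h1

/-- Away from the critical values, the fibres of the Chebyshev polynomial have `d` elements. -/
theorem card_roots_T_sub_C {d : ℕ} (hd : d ≠ 0) {c : ℂ} (h1 : c ≠ -1) (h2 : c ≠ 1) :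
    (Polynomial.Chebyshev.T ℂ d - Polynomial.C c).roots.toFinset.card = d := by
  have hdeg : (Polynomial.Chebyshev.T ℂ d - Polynomial.C c).natDegree = d := by
    rw [Polynomial.natDegree_sub_C, Polynomial.Chebyshev.natDegree_T]; simp
  have h0 : Polynomial.Chebyshev.T ℂ d - Polynomial.C c ≠ 0 := by
    intro h
    rw [h, Polynomial.natDegree_zero] at hdeg
    exact hd hdeg.symm
  rw [card_toFinset_roots_of_simple h0, hdeg]
  intro x hx hx'
  simp only [Polynomial.eval_sub, Polynomial.eval_C, sub_eq_zero, Polynomial.derivative_sub,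
    Polynomial.derivative_C, sub_zero] at hx hx'
  rcases eval_T_of_derivative_eq_zero hd hx' with h | h
  · exact h1 (hx.symm.trans h)
  · exact h2 (hx.symm.trans h)

theorem derivative_T_ne_zero {d : ℕ} (hd : d ≠ 0) :
    (Polynomial.Chebyshev.T ℂ d).derivative ≠ 0 := by
  intro h
  have := eval_derivative_derivative_T_ne_zero hd (x := 0) (by rw [h, Polynomial.eval_zero])
  simp [h] at this

/-- The Chebyshev polynomial has `d - 1` distinct critical points. -/
theorem card_roots_derivative_T {d : ℕ} (hd : d ≠ 0) :
    (Polynomial.Chebyshev.T ℂ d).derivative.roots.toFinset.card = d - 1 := by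
  rw [card_toFinset_roots_of_simple (derivative_T_ne_zero hd) fun x =>
    eval_derivative_derivative_T_ne_zero hd]
  have hT : (Polynomial.Chebyshev.T ℂ d).natDegree = d := by
    rw [Polynomial.Chebyshev.natDegree_T]; simp
  rw [Polynomial.natDegree_eq_of_degree_eq_some (Polynomial.degree_derivative (by omega)), hT]

/-! ### Factoring the equations -/

/-- The linear form `λ_0 a_{0j} - ∑_i λ_i a_{ij}`. -/
def multiplierForm {n s : ℕ} (v : Fin (s + 1) → ℂ) (j : Fin n) : ℂ :=
  v 0 * (a n 0 (j + 1) : ℂ) - ∑ i : Fin s, v i.succ * (a n (i + 1) (j + 1) : ℂ)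

/-- The affine form `a_{i0} + ∑_j a_{ij} y_j`. -/
def affineForm {n : ℕ} (i : ℕ) (y : Fin n → ℂ) : ℂ :=
  (a n i 0 : ℂ) + ∑ j : Fin n, (a n i (j + 1) : ℂ) * y j

/-- The indices `j` for which `x_j` is not a critical point of `T_d`. -/
def noncritical {n : ℕ} (d : ℕ) (x : Fin n → ℂ) : Finset (Fin n) := by
  classical
  exact Finset.univ.filter fun j => (Polynomial.Chebyshev.T ℂ d).derivative.eval (x j) ≠ 0

theorem mem_noncritical {n d : ℕ} {x : Fin n → ℂ} {j : Fin n} :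
    j ∈ noncritical d x ↔ (Polynomial.Chebyshev.T ℂ d).derivative.eval (x j) ≠ 0 := by
  simp [noncritical]

theorem aeval_polynomial_aeval_X {σ : Type*} (z : σ → ℂ) (k : σ) (p : Polynomial ℚ) :
    aeval z (Polynomial.aeval (X k : MvPolynomial σ ℚ) p) =
      (p.map (algebraMap ℚ ℂ)).eval (z k) := by
  rw [← Polynomial.aeval_algHom_apply, aeval_X, Polynomial.aeval_def, Polynomial.eval_map]

theorem map_T (d : ℕ) : (Polynomial.Chebyshev.T ℚ (d : ℤ)).map (algebraMap ℚ ℂ) =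
    Polynomial.Chebyshev.T ℂ d :=
  Polynomial.Chebyshev.map_T _ _

theorem map_derivative_T (d : ℕ) :
    (Polynomial.Chebyshev.T ℚ (d : ℤ)).derivative.map (algebraMap ℚ ℂ) =
      (Polynomial.Chebyshev.T ℂ d).derivative := by
  rw [← Polynomial.derivative_map, map_T]

theorem map_derivative_derivative_T (d : ℕ) :
    (Polynomial.Chebyshev.T ℚ (d : ℤ)).derivative.derivative.map (algebraMap ℚ ℂ) =
      (Polynomial.Chebyshev.T ℂ d).derivative.derivative := by
  rw [← Polynomial.derivative_map, map_derivative_T]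

theorem pderiv_polynomial_aeval_X {σ : Type*} [DecidableEq σ] (k l : σ) (p : Polynomial ℚ) :
    pderiv k (Polynomial.aeval (X l : MvPolynomial σ ℚ) p) =
      if l = k then Polynomial.aeval (X l : MvPolynomial σ ℚ) p.derivative else 0 := by
  rw [Derivation.comp_aeval_eq, pderiv_X, smul_eq_mul]
  by_cases h : l = k
  · subst h; simp
  · simp [h]

theorem pderiv_sum_chebyshevX {n : ℕ} (d : ℕ) (j : Fin n) (b : Fin n → ℚ) :
    pderiv j (∑ k : Fin n, C (b k) * chebyshevX n d k) =
      C (b j) * Polynomial.aeval (X j) (Polynomial.Chebyshev.T ℚ (d : ℤ)).derivative := by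
  rw [map_sum, Finset.sum_eq_single j]
  · rw [pderiv_C_mul, chebyshevX, pderiv_polynomial_aeval_X, if_pos rfl]
  · intro k _ hk
    rw [pderiv_C_mul, chebyshevX, pderiv_polynomial_aeval_X, if_neg hk, mul_zero]
  · simp

theorem pderiv_gTilde (n d : ℕ) (j : Fin n) :
    pderiv j (gTilde n d) = C (a n 0 (j + 1)) *
      Polynomial.aeval (X j) (Polynomial.Chebyshev.T ℚ (d : ℤ)).derivative :=
  pderiv_sum_chebyshevX d j fun k => a n 0 (k + 1)

theorem pderiv_fTilde (n d i : ℕ) (j : Fin n) :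
    pderiv j (fTilde n d i) = C (a n i (j + 1)) *
      Polynomial.aeval (X j) (Polynomial.Chebyshev.T ℚ (d : ℤ)).derivative := by
  rw [← pderiv_sum_chebyshevX d j fun k => a n i (k + 1)]
  simp [fTilde]

theorem aeval_fTilde (n d i : ℕ) (x : Fin n → ℂ) :
    aeval x (fTilde n d i) =
      affineForm i fun j => (Polynomial.Chebyshev.T ℂ d).eval (x j) + 1 := by
  simp only [fTilde, affineForm, chebyshevX, aeval_polynomial_aeval_X, map_T, map_add, map_sum,
    map_mul, map_one, aeval_C, eq_ratCast]

theorem aeval_gTildeJ_eq_mul (n d s : ℕ) (j : Fin n) (x : Fin n → ℂ) (v : Fin (s + 1) → ℂ) :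
    aeval (Sum.elim x v) (gTildeJ n d s j) =
      (Polynomial.Chebyshev.T ℂ d).derivative.eval (x j) * multiplierForm v j := by
  rw [aeval_gTildeJ]
  simp only [pderiv_gTilde, pderiv_fTilde, map_mul, aeval_polynomial_aeval_X, map_derivative_T,
    multiplierForm, aeval_C, eq_ratCast]
  rw [mul_sub, Finset.mul_sum]
  congr 1
  · ring
  · exact Finset.sum_congr rfl fun i _ => by ring

theorem mk_mem_startVariety_iff {n d s : ℕ} {x : Fin n → ℂ} {v : Fin (s + 1) → ℂ} (hv : v ≠ 0) :
    (x, Projectivization.mk ℂ v hv) ∈ startVariety n d s ↔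
      (∀ i : Fin s, affineForm (i + 1)
        (fun j => (Polynomial.Chebyshev.T ℂ d).eval (x j) + 1) = 0) ∧
      ∀ j ∈ noncritical d x, multiplierForm v j = 0 := by
  rw [mk_mem_startVariety]
  refine and_congr (forall_congr' fun i => by rw [aeval_fTilde]) (forall_congr' fun j => ?_)
  rw [aeval_gTildeJ_eq_mul, mul_eq_zero, mem_noncritical, or_iff_not_imp_left]

/-! ### Multipliers and the number of noncritical indices -/

/-- A vector of multipliers which annihilates `s + 1` columns vanishes. -/
theorem eq_zero_of_multiplierForm_eq_zero {n s : ℕ} {v : Fin (s + 1) → ℂ} {J : Finset (Fin n)}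
    (hJ : s + 1 ≤ J.card) (h : ∀ j ∈ J, multiplierForm v j = 0) : v = 0 := by
  have := a_rows_independent (I := (Finset.univ : Finset (Fin (s + 1)))) (r := fun i => (i : ℕ))
    (fun _ _ _ _ hik => Fin.ext hik) (by simpa using hJ)
    -- The signs turn `multiplierForm` into a plain combination of rows `0, …, s`.
    (c := Fin.cons (v 0) fun i : Fin s => -v i.succ) (fun j hj => ?_)
  · ext i
    refine Fin.cases ?_ (fun i => ?_) i
    · simpa using this 0 (Finset.mem_univ _)
    · simpa using this i.succ (Finset.mem_univ _)
  · rw [← h j hj, multiplierForm, Fin.sum_univ_succ]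
    simp [sub_eq_add_neg, mul_comm]

/-- A vector of multipliers with `λ_0 = 0` which annihilates `s` columns vanishes. -/
theorem eq_zero_of_multiplierForm_eq_zero_of_zero {n s : ℕ} {v : Fin (s + 1) → ℂ}
    {J : Finset (Fin n)} (hJ : s ≤ J.card) (h0 : v 0 = 0)
    (h : ∀ j ∈ J, multiplierForm v j = 0) : v = 0 := by
  have := a_rows_independent (I := (Finset.univ : Finset (Fin s))) (r := fun i => (i : ℕ) + 1)
    (fun _ _ _ _ hik => Fin.ext (by simpa using hik)) (by simpa using hJ)
    (c := fun i : Fin s => v i.succ) (fun j hj => ?_)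
  · ext i
    exact Fin.cases h0 (fun i => this i (Finset.mem_univ _)) i
  · have := h j hj
    rw [multiplierForm, h0, zero_mul, zero_sub, neg_eq_zero] at this
    rw [← this]
    exact Finset.sum_congr rfl fun i _ => mul_comm _ _

/-- On the zero set of the `f̃_i`, at least `s` coordinates are not critical points of `T_d`. -/
theorem le_card_noncritical {n d s : ℕ} (hd : d ≠ 0) {x : Fin n → ℂ}
    (h : ∀ i : Fin s, affineForm (i + 1)
      (fun j => (Polynomial.Chebyshev.T ℂ d).eval (x j) + 1) = 0) :
    s ≤ (noncritical d x).card := by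
  by_contra! hlt
  obtain ⟨i, hi, hne⟩ := exists_row_ne_zero (noncritical d x)
    (fun j => (Polynomial.Chebyshev.T ℂ d).eval (x j) + 1) fun j hj => by
      rw [mem_noncritical, not_not] at hj
      rcases eval_T_of_derivative_eq_zero hd hj with h | h
      · left; rw [h]; ring
      · right; rw [h]; ring
  exact hne (h ⟨i, by omega⟩)

theorem card_noncritical {n d s : ℕ} (hd : d ≠ 0) {x : Fin n → ℂ} {v : Fin (s + 1) → ℂ}
    (hv : v ≠ 0)
    (h : ∀ i : Fin s, affineForm (i + 1)
      (fun j => (Polynomial.Chebyshev.T ℂ d).eval (x j) + 1) = 0)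
    (hvx : ∀ j ∈ noncritical d x, multiplierForm v j = 0) :
    (noncritical d x).card = s := by
  refine le_antisymm ?_ (le_card_noncritical hd h)
  by_contra! hlt
  exact hv (eq_zero_of_multiplierForm_eq_zero hlt hvx)

/-- There are `s + 1` unknowns and only `s` linear conditions. -/
theorem exists_multipliers {n s : ℕ} {J : Finset (Fin n)} (hJ : J.card = s) :
    ∃ v : Fin (s + 1) → ℂ, v ≠ 0 ∧ ∀ j ∈ J, multiplierForm v j = 0 := by
  let F : (Fin (s + 1) → ℂ) →ₗ[ℂ] (J → ℂ) :=
    { toFun := fun v j => multiplierForm v (j : Fin n)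
      map_add' := fun v w => by
        ext j
        simp only [multiplierForm, Pi.add_apply, add_mul, Finset.sum_add_distrib]
        ring
      map_smul' := fun c v => by
        ext j
        simp only [multiplierForm, Pi.smul_apply, smul_eq_mul, RingHom.id_apply, mul_sub,
          Finset.mul_sum, mul_assoc] }
  have hker : LinearMap.ker F ≠ ⊥ := F.ker_ne_bot_of_finrank_lt (by simp [hJ])
  obtain ⟨v, hv, hv0⟩ := Submodule.exists_mem_ne_zero_of_ne_bot hker
  exact ⟨v, hv0, fun j hj => congrFun (LinearMap.mem_ker.mp hv) ⟨j, hj⟩⟩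

/-- The values `y_j` for `j ∉ J` extend to a unique solution of the linear system. -/
theorem existsUnique_affineForm_eq_zero {n s : ℕ} {J : Finset (Fin n)} (hJ : J.card = s)
    (y : Fin n → ℂ) :
    ∃! z : Fin n → ℂ, (∀ j ∉ J, z j = y j) ∧ ∀ i : Fin s, affineForm (i + 1) z = 0 := by
  have hindep : ∀ c : Fin n → ℂ,
      (∀ i : Fin s, ∑ j ∈ J, (a n (i + 1) (j + 1) : ℂ) * c j = 0) → ∀ j ∈ J, c j = 0 :=
    fun c hc => a_columns_independent (I := (Finset.univ : Finset (Fin s)))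
      (r := fun i => (i : ℕ) + 1) (fun _ _ _ _ hik => Fin.ext (by simpa using hik))
      (by simp [hJ]) fun i _ => hc i
  let F : (J → ℂ) →ₗ[ℂ] (Fin s → ℂ) :=
    Matrix.toLin' (Matrix.of fun (i : Fin s) (j : J) => (a n (i + 1) ((j : Fin n) + 1) : ℂ))
  have hF : ∀ (c : Fin n → ℂ) (i : Fin s),
      F (fun j => c j) i = ∑ j ∈ J, (a n (i + 1) (j + 1) : ℂ) * c j := by
    intro c i
    simp only [F, Matrix.toLin'_apply, Matrix.mulVec, dotProduct, Matrix.of_apply]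
    exact Finset.sum_coe_sort J fun j => (a n (i + 1) (j + 1) : ℂ) * c j
  have hext : ∀ c : J → ℂ, ∃ c' : Fin n → ℂ, (fun j : J => c' j) = c := by
    intro c
    refine ⟨fun j => if h : j ∈ J then c ⟨j, h⟩ else 0, ?_⟩
    ext j
    simp
  have hinj : Function.Injective F := by
    rw [injective_iff_map_eq_zero]
    intro c hc
    obtain ⟨c, rfl⟩ := hext c
    ext j
    exact hindep c (fun i => by rw [← hF, hc]; rfl) j j.2
  have hsurj : Function.Surjective F :=
    (LinearMap.injective_iff_surjective_of_finrank_eq_finrank (by simp [hJ])).mp hinj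
  have hsplit : ∀ (i : ℕ) (z : Fin n → ℂ), affineForm i z =
      ((a n i 0 : ℂ) + ∑ j ∈ Finset.univ.filter (· ∉ J), (a n i (j + 1) : ℂ) * z j) +
        ∑ j ∈ J, (a n i (j + 1) : ℂ) * z j := by
    intro i z
    rw [affineForm, ← Finset.sum_filter_not_add_sum_filter Finset.univ (· ∈ J), add_assoc]
    congr 3
    ext; simp
  obtain ⟨c, hc⟩ := hsurj fun i => -((a n (i + 1) 0 : ℂ) +
    ∑ j ∈ Finset.univ.filter (· ∉ J), (a n (i + 1) (j + 1) : ℂ) * y j)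
  obtain ⟨c, rfl⟩ := hext c
  refine ⟨fun j => if j ∈ J then c j else y j, ⟨fun j hj => by simp [hj], fun i => ?_⟩, ?_⟩
  · have hi := congrFun hc i
    rw [hF] at hi
    rw [hsplit, Finset.sum_congr rfl fun j hj => by rw [if_neg (Finset.mem_filter.mp hj).2],
      Finset.sum_congr (s₁ := J) rfl fun j hj => by rw [if_pos hj], hi, add_neg_cancel]
  · rintro z ⟨hz, hzi⟩
    have := hindep (fun j => z j - c j) fun i => by
      have hi := congrFun hc i
      rw [hF] at hi
      have hzi := hzi i
      rw [hsplit, Finset.sum_congr rfl fun j hj => by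
        rw [hz j (Finset.mem_filter.mp hj).2]] at hzi
      simp only [mul_sub, Finset.sum_sub_distrib]
      linear_combination hzi - hi
    ext j
    by_cases hj : j ∈ J
    · simpa [hj] using sub_eq_zero.mp (this j hj)
    · simp [hj, hz j hj]

/-! ### The Jacobian -/

theorem dehomogenize_gTildeJ (n d s : ℕ) (j : Fin n) :
    dehomogenize (gTildeJ n d s j) =
      (C (a n 0 (j + 1)) - ∑ i : Fin s, C (a n (i + 1) (j + 1)) * X (Sum.inr i)) *
        Polynomial.aeval (X (Sum.inl j)) (Polynomial.Chebyshev.T ℚ (d : ℤ)).derivative := by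
  simp only [gTildeJ, dehomogenize, pderiv_gTilde, pderiv_fTilde, map_sub, map_mul, map_sum,
    aeval_X, Sum.elim_inr, Sum.elim_inl, Fin.cons_zero, Fin.cons_succ, one_mul,
    ← Polynomial.aeval_algHom_apply, rename_X, sub_mul, Finset.sum_mul, algHom_C, algebraMap_eq]
  congr 1
  exact Finset.sum_congr rfl fun i _ => by ring

theorem aeval_pderiv_inl_inl (n d s : ℕ) (x : Fin n → ℂ) (l : Fin s → ℂ) (j k : Fin n) :
    aeval (Sum.elim x l) (pderiv (Sum.inl k) (affineSystem n d s (Sum.inl j))) =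
      if j = k then multiplierForm (Fin.cons 1 l) j *
        (Polynomial.Chebyshev.T ℂ d).derivative.derivative.eval (x j) else 0 := by
  simp only [affineSystem, Sum.elim_inl, dehomogenize_gTildeJ, pderiv_mul, map_sub, map_sum,
    pderiv_C, pderiv_X, pderiv_polynomial_aeval_X, map_add, map_mul, Sum.inl.injEq]
  split_ifs with h
  · simp [aeval_polynomial_aeval_X, map_derivative_derivative_T, multiplierForm, mul_comm]
  · simp

theorem aeval_pderiv_inl_inr (n d s : ℕ) (x : Fin n → ℂ) (l : Fin s → ℂ) (j : Fin n) (i : Fin s) :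
    aeval (Sum.elim x l) (pderiv (Sum.inr i) (affineSystem n d s (Sum.inl j))) =
      -((a n (i + 1) (j + 1) : ℂ) * (Polynomial.Chebyshev.T ℂ d).derivative.eval (x j)) := by
  simp only [affineSystem, Sum.elim_inl, dehomogenize_gTildeJ, pderiv_mul, map_sub, map_sum,
    pderiv_C, pderiv_X, pderiv_polynomial_aeval_X, map_add, map_mul,
    aeval_polynomial_aeval_X, map_derivative_T]
  simp [Pi.single_apply]

theorem rename_fTilde (n d s i : ℕ) :
    rename (Sum.inl : Fin n → Fin n ⊕ Fin s) (fTilde n d i) =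
      C (a n i 0) + ∑ j : Fin n, C (a n i (j + 1)) *
        (Polynomial.aeval (X (Sum.inl j)) (Polynomial.Chebyshev.T ℚ (d : ℤ)) + 1) := by
  simp only [fTilde, chebyshevX, map_add, map_sum, map_mul, map_one, rename_C,
    ← Polynomial.aeval_algHom_apply, rename_X]

theorem aeval_pderiv_inr_inl (n d s : ℕ) (x : Fin n → ℂ) (l : Fin s → ℂ) (i : Fin s) (k : Fin n) :
    aeval (Sum.elim x l) (pderiv (Sum.inl k) (affineSystem n d s (Sum.inr i))) =
      (a n (i + 1) (k + 1) : ℂ) * (Polynomial.Chebyshev.T ℂ d).derivative.eval (x k) := by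
  simp only [affineSystem, Sum.elim_inr, rename_fTilde, map_add, map_sum, pderiv_C, pderiv_C_mul,
    pderiv_polynomial_aeval_X, pderiv_one, Sum.inl.injEq, add_zero, zero_add, mul_ite, mul_zero,
    Finset.sum_ite_eq', Finset.mem_univ, if_true, map_mul, aeval_polynomial_aeval_X,
    map_derivative_T, aeval_C, eq_ratCast, Sum.elim_inl]

theorem aeval_pderiv_inr_inr (n d s : ℕ) (x : Fin n → ℂ) (l : Fin s → ℂ) (i i' : Fin s) :
    aeval (Sum.elim x l) (pderiv (Sum.inr i') (affineSystem n d s (Sum.inr i))) = 0 := by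
  simp only [affineSystem, Sum.elim_inr, rename_fTilde, map_add, map_sum, pderiv_C, pderiv_C_mul,
    pderiv_polynomial_aeval_X, pderiv_one, reduceCtorEq, if_false, add_zero, mul_zero,
    Finset.sum_const_zero, map_zero]

/-- A kernel vector is eliminated in three stages. At critical `j` the row of `g̃_j` is diagonal
with nonzero entry, killing the `x_j` component. At noncritical `j` the diagonal entry vanishes,
leaving a row relation on `s` columns that kills the `λ` components. The rows of the `f̃_i` then
give a column relation that kills the other `x_j` components. -/
theorem aeval_jacobianDet_ne_zero {n d s : ℕ} (hd : d ≠ 0) {x : Fin n → ℂ} {l : Fin s → ℂ}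
    (hcard : (noncritical d x).card = s)
    (h : ∀ j, multiplierForm (Fin.cons 1 l : Fin (s + 1) → ℂ) j = 0 ↔ j ∈ noncritical d x) :
    aeval (Sum.elim x l) (jacobianDet n d s) ≠ 0 := by
  rw [jacobianDet, AlgHom.map_det]
  intro hdet
  obtain ⟨w, hw0, hw⟩ := Matrix.exists_mulVec_eq_zero_iff.mpr hdet
  have hg : ∀ j : Fin n, multiplierForm (Fin.cons 1 l) j *
      (Polynomial.Chebyshev.T ℂ d).derivative.derivative.eval (x j) * w (Sum.inl j) =
      (∑ i : Fin s, (a n (i + 1) (j + 1) : ℂ) * w (Sum.inr i)) *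
        (Polynomial.Chebyshev.T ℂ d).derivative.eval (x j) := by
    intro j
    have := congrFun hw (Sum.inl j)
    simp only [Matrix.mulVec, dotProduct, Fintype.sum_sum_type, AlgHom.mapMatrix_apply,
      Matrix.map_apply, Matrix.of_apply, aeval_pderiv_inl_inl, aeval_pderiv_inl_inr, ite_mul,
      zero_mul, Finset.sum_ite_eq, Finset.mem_univ, if_true, Pi.zero_apply, neg_mul,
      Finset.sum_neg_distrib] at this
    rw [add_neg_eq_zero.mp this, Finset.sum_mul]
    exact Finset.sum_congr rfl fun i _ => by ring
  have hf : ∀ i : Fin s, ∑ j : Fin n, (a n (i + 1) (j + 1) : ℂ) *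
      ((Polynomial.Chebyshev.T ℂ d).derivative.eval (x j) * w (Sum.inl j)) = 0 := by
    intro i
    have := congrFun hw (Sum.inr i)
    simpa only [Pi.zero_apply, Matrix.mulVec, dotProduct, Fintype.sum_sum_type,
      AlgHom.mapMatrix_apply, Matrix.map_apply, Matrix.of_apply, aeval_pderiv_inr_inl,
      aeval_pderiv_inr_inr, zero_mul, Finset.sum_const_zero, add_zero, mul_assoc] using this
  have hx : ∀ j ∉ noncritical d x, w (Sum.inl j) = 0 := by
    intro j hj
    have hj' : (Polynomial.Chebyshev.T ℂ d).derivative.eval (x j) = 0 := by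
      rwa [mem_noncritical, not_not] at hj
    have := hg j
    rw [hj', mul_zero] at this
    exact (mul_eq_zero.mp this).resolve_left (mul_ne_zero (fun h0 => hj ((h j).mp h0))
      (eval_derivative_derivative_T_ne_zero hd hj'))
  have hl : ∀ i : Fin s, w (Sum.inr i) = 0 := fun i =>
    a_rows_independent (I := (Finset.univ : Finset (Fin s))) (r := fun i => (i : ℕ) + 1)
      (fun _ _ _ _ hik => Fin.ext (by simpa using hik)) (J := noncritical d x) (by simp [hcard])
      (c := fun i : Fin s => w (Sum.inr i)) (fun j hj => by
        have := hg j
        rw [(h j).mpr hj, zero_mul, zero_mul] at this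
        exact (mul_eq_zero.mp this.symm).resolve_right (mem_noncritical.mp hj)) i
      (Finset.mem_univ i)
  have hx' : ∀ j ∈ noncritical d x, w (Sum.inl j) = 0 := by
    intro j hj
    refine (mul_eq_zero.mp (a_columns_independent (I := (Finset.univ : Finset (Fin s)))
      (r := fun i => (i : ℕ) + 1) (fun _ _ _ _ hik => Fin.ext (by simpa using hik))
      (by simp [hcard])
      (c := fun j => (Polynomial.Chebyshev.T ℂ d).derivative.eval (x j) * w (Sum.inl j))
      (fun i _ => ?_) j hj)).resolve_left (mem_noncritical.mp hj)
    rw [← hf i]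
    exact Finset.sum_subset (Finset.subset_univ _) fun j _ hj => by rw [hx j hj]; ring
  refine hw0 (funext fun r => ?_)
  rcases r with j | i
  · by_cases hj : j ∈ noncritical d x
    · exact hx' j hj
    · exact hx j hj
  · exact hl i

/-! ### Points of the variety -/

theorem multiplierForm_smul {n s : ℕ} (c : ℂ) (v : Fin (s + 1) → ℂ) (j : Fin n) :
    multiplierForm (c • v) j = c * multiplierForm v j := by
  simp only [multiplierForm, Pi.smul_apply, smul_eq_mul, mul_sub, Finset.mul_sum, mul_assoc]

theorem multiplierForm_sub {n s : ℕ} (v w : Fin (s + 1) → ℂ) (j : Fin n) :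
    multiplierForm (v - w) j = multiplierForm v j - multiplierForm w j := by
  simp only [multiplierForm, Pi.sub_apply, sub_mul, Finset.sum_sub_distrib]
  ring

theorem mem_startVariety_iff {n d s : ℕ}
    {w : (Fin n → ℂ) × Projectivization ℂ (Fin (s + 1) → ℂ)} :
    w ∈ startVariety n d s ↔
      (∀ i : Fin s, affineForm (i + 1)
        (fun j => (Polynomial.Chebyshev.T ℂ d).eval (w.1 j) + 1) = 0) ∧
      ∀ j ∈ noncritical d w.1, multiplierForm w.2.rep j = 0 := by
  rw [← mk_mem_startVariety_iff w.2.rep_nonzero, w.2.mk_rep]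

theorem card_noncritical_of_mem {n d s : ℕ} (hd : d ≠ 0)
    {w : (Fin n → ℂ) × Projectivization ℂ (Fin (s + 1) → ℂ)} (hw : w ∈ startVariety n d s) :
    (noncritical d w.1).card = s :=
  card_noncritical hd w.2.rep_nonzero (mem_startVariety_iff.mp hw).1
    (mem_startVariety_iff.mp hw).2

theorem rep_zero_ne_zero_of_mem {n d s : ℕ} (hd : d ≠ 0)
    {w : (Fin n → ℂ) × Projectivization ℂ (Fin (s + 1) → ℂ)} (hw : w ∈ startVariety n d s) :
    w.2.rep 0 ≠ 0 := fun h0 =>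
  w.2.rep_nonzero (eq_zero_of_multiplierForm_eq_zero_of_zero (card_noncritical_of_mem hd hw).ge h0
    (mem_startVariety_iff.mp hw).2)

theorem injOn_fst_startVariety {n d s : ℕ} (hd : d ≠ 0) :
    Set.InjOn Prod.fst (startVariety n d s) := by
  rintro ⟨x, L⟩ hL ⟨x', M⟩ hM hxx
  obtain rfl : x = x' := hxx
  have hL0 := rep_zero_ne_zero_of_mem hd hL
  have hM0 := rep_zero_ne_zero_of_mem hd hM
  -- This combination has zeroth coordinate `0` and still annihilates the `s` noncritical columns.
  have h : M.rep 0 • L.rep - L.rep 0 • M.rep = 0 := by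
    refine eq_zero_of_multiplierForm_eq_zero_of_zero (card_noncritical_of_mem hd hL).ge
      (by simp [mul_comm]) fun j hj => ?_
    rw [multiplierForm_sub, multiplierForm_smul, multiplierForm_smul,
      (mem_startVariety_iff.mp hL).2 j hj, (mem_startVariety_iff.mp hM).2 j hj]
    simp
  refine Prod.ext rfl ?_
  rw [← L.mk_rep, ← M.mk_rep, Projectivization.mk_eq_mk_iff']
  refine ⟨L.rep 0 / M.rep 0, ?_⟩
  rw [div_eq_inv_mul, mul_smul, ← sub_eq_zero.mp h, smul_smul, inv_mul_cancel₀ hM0, one_smul]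

theorem aeval_jacobianDet_ne_zero_of_mem {n d s : ℕ} (hd : d ≠ 0)
    {w : (Fin n → ℂ) × Projectivization ℂ (Fin (s + 1) → ℂ)} (hw : w ∈ startVariety n d s) :
    aeval (Sum.elim w.1 (affineCoord w.2)) (jacobianDet n d s) ≠ 0 := by
  have h0 := rep_zero_ne_zero_of_mem hd hw
  have hcard := card_noncritical_of_mem hd hw
  have hvec : (Fin.cons 1 (affineCoord w.2) : Fin (s + 1) → ℂ) = (w.2.rep 0)⁻¹ • w.2.rep := by
    ext i
    refine Fin.cases ?_ (fun i => ?_) i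
    · simp [h0]
    · simp [affineCoord, div_eq_inv_mul]
  refine aeval_jacobianDet_ne_zero hd hcard fun j => ?_
  rw [hvec, multiplierForm_smul, mul_eq_zero, or_iff_right (inv_ne_zero h0)]
  refine ⟨fun hj => ?_, (mem_startVariety_iff.mp hw).2 j⟩
  -- A form vanishing at a further index would give `s + 1` annihilated columns, forcing the
  -- multipliers to be zero.
  by_contra hjn
  refine w.2.rep_nonzero (eq_zero_of_multiplierForm_eq_zero (J := insert j (noncritical d w.1)) ?_
    fun k hk => ?_)
  · rw [Finset.card_insert_of_notMem hjn, hcard]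
  · rcases Finset.mem_insert.mp hk with rfl | hk
    · exact hj
    · exact (mem_startVariety_iff.mp hw).2 k hk

/-! ### Counting the projected points -/

/-- The points `x` on the zero set of the `f̃_i` with exactly `s` noncritical coordinates. -/
def criticalPoints (n d s : ℕ) : Set (Fin n → ℂ) :=
  {x | (∀ i : Fin s, affineForm (i + 1)
    (fun j => (Polynomial.Chebyshev.T ℂ d).eval (x j) + 1) = 0) ∧ (noncritical d x).card = s}

theorem fst_image_startVariety {n d s : ℕ} (hd : d ≠ 0) :
    Prod.fst '' startVariety n d s = criticalPoints n d s := by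
  ext x
  constructor
  · rintro ⟨w, hw, rfl⟩
    exact ⟨(mem_startVariety_iff.mp hw).1, card_noncritical_of_mem hd hw⟩
  · rintro ⟨hf, hcard⟩
    obtain ⟨v, hv, hvj⟩ := exists_multipliers hcard
    exact ⟨(x, Projectivization.mk ℂ v hv), (mk_mem_startVariety_iff hv).mpr ⟨hf, hvj⟩, rfl⟩

/-- The solution of the linear system with prescribed noncritical indices `J` and critical
coordinates `r`. -/
theorem exists_solution {n d s : ℕ} (hd : d ≠ 0) (J : Finset (Fin n)) (r : Fin n → ℂ) :
    ∃ z : Fin n → ℂ, J.card = s →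
      (∀ j ∉ J, (Polynomial.Chebyshev.T ℂ d).derivative.eval (r j) = 0) →
      (∀ i : Fin s, affineForm (i + 1) z = 0) ∧ (∀ j ∈ J, z j ≠ 0 ∧ z j ≠ 2) ∧
      ∀ y : Fin n → ℂ, (∀ j ∉ J, y j = (Polynomial.Chebyshev.T ℂ d).eval (r j) + 1) →
        ((∀ i : Fin s, affineForm (i + 1) y = 0) ↔ ∀ j ∈ J, y j = z j) := by
  by_cases hJ : J.card = s
  swap
  -- The hypotheses sit inside the existential so that a solution can be chosen for all `J` and `r`
  -- at once; here the value is irrelevant.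
  · exact ⟨0, fun h => absurd h hJ⟩
  obtain ⟨z, ⟨hzr, hz⟩, huniq⟩ := existsUnique_affineForm_eq_zero hJ
    fun j => (Polynomial.Chebyshev.T ℂ d).eval (r j) + 1
  refine ⟨z, fun _ hr => ⟨hz, fun j hj => ?_, fun y hy => ⟨fun hyf j _ => ?_, fun hyz => ?_⟩⟩⟩
  · rw [← not_or]
    intro hj02
    -- If `z j` were `0` or `2`, only `s - 1` indices would remain free, so one of the `s` equations
    -- would fail.
    obtain ⟨i, hi, hne⟩ := exists_row_ne_zero (J.erase j) z fun k hk => by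
      by_cases hkj : k = j
      · rwa [hkj]
      · have hkJ : k ∉ J := fun h => hk (Finset.mem_erase.mpr ⟨hkj, h⟩)
        rw [hzr k hkJ]
        rcases eval_T_of_derivative_eq_zero hd (hr k hkJ) with h | h
        · left; rw [h]; ring
        · right; rw [h]; ring
    rw [Finset.card_erase_add_one hj, hJ] at hi
    exact hne (hz ⟨i, hi⟩)
  · rw [huniq y ⟨hy, hyf⟩]
  · have : y = z := by
      ext j
      by_cases hj : j ∈ J
      · exact hyz j hj
      · rw [hy j hj, hzr j hj]
    rwa [this]

theorem finite_and_ncard_criticalPoints {n d s : ℕ} (hd : d ≠ 0) :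
    (criticalPoints n d s).Finite ∧
      (criticalPoints n d s).ncard = n.choose s * d ^ s * (d - 1) ^ (n - s) := by
  classical
  choose Z hZ using fun (J : Finset (Fin n)) (r : Fin n → ℂ) => exists_solution (s := s) hd J r
  let T := Polynomial.Chebyshev.T ℂ d
  let R : Finset ℂ := T.derivative.roots.toFinset
  have hR : ∀ z, z ∈ R ↔ T.derivative.eval z = 0 := by
    intro z
    simp only [R, Multiset.mem_toFinset, Polynomial.mem_roots (derivative_T_ne_zero hd), T,
      Polynomial.IsRoot.def]
  let D : ℂ → Finset ℂ := fun c => (T - Polynomial.C c).roots.toFinset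
  have hT : ∀ c : ℂ, T - Polynomial.C c ≠ 0 := by
    intro c hc
    have := derivative_T_ne_zero hd
    rw [sub_eq_zero.mp (show Polynomial.Chebyshev.T ℂ d - _ = 0 from hc)] at this
    exact this Polynomial.derivative_C
  have hD : ∀ c z, z ∈ D c ↔ T.eval z = c := by
    intro c z
    simp only [D, Multiset.mem_toFinset, Polynomial.mem_roots (hT c), Polynomial.IsRoot.def,
      Polynomial.eval_sub, Polynomial.eval_C, sub_eq_zero]
  -- `A J` lists the choices of critical coordinates. Entries in `J` are pinned to `0` only to make
  -- `r` unique.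
  let A : Finset (Fin n) → Finset (Fin n → ℂ) := fun J =>
    Fintype.piFinset fun j => if j ∈ J then {0} else R
  let B : Finset (Fin n) → (Fin n → ℂ) → Finset (Fin n → ℂ) := fun J r =>
    Fintype.piFinset fun j => if j ∈ J then D (Z J r j - 1) else {r j}
  let S : Finset (Σ _ : Finset (Fin n), Σ _ : Fin n → ℂ, Fin n → ℂ) :=
    (Finset.powersetCard s Finset.univ).sigma fun J => (A J).sigma fun r => B J r
  have hA : ∀ J r, r ∈ A J ↔ (∀ j ∈ J, r j = 0) ∧ ∀ j ∉ J, T.derivative.eval (r j) = 0 := by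
    intro J r
    simp only [A, Fintype.mem_piFinset]
    refine ⟨fun h => ⟨fun j hj => by simpa [hj] using h j,
      fun j hj => by simpa [hj, hR] using h j⟩, fun h j => ?_⟩
    by_cases hj : j ∈ J
    · simpa [hj] using h.1 j hj
    · simpa [hj, hR] using h.2 j hj
  have hB : ∀ J r x, x ∈ B J r ↔ (∀ j ∈ J, T.eval (x j) = Z J r j - 1) ∧ ∀ j ∉ J, x j = r j := by
    intro J r x
    simp only [B, Fintype.mem_piFinset]
    refine ⟨fun h => ⟨fun j hj => by simpa [hj, hD] using h j,
      fun j hj => by simpa [hj] using h j⟩, fun h j => ?_⟩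
    by_cases hj : j ∈ J
    · simpa [hj, hD] using h.1 j hj
    · simpa [hj] using h.2 j hj
  have hnc : ∀ J r x, J.card = s → r ∈ A J → x ∈ B J r → noncritical d x = J := by
    intro J r x hJ hr hx
    rw [hA] at hr
    rw [hB] at hx
    ext j
    rw [mem_noncritical]
    by_cases hj : j ∈ J
    · simp only [hj, iff_true]
      intro h0
      have hz := (hZ J r hJ hr.2).2.1 j hj
      have hxj := hx.1 j hj
      rcases eval_T_of_derivative_eq_zero hd h0 with h | h
      · exact hz.1 (by linear_combination h - hxj)
      · exact hz.2 (by linear_combination h - hxj)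
    · simp only [hj, iff_false, not_not]
      rw [hx.2 j hj]
      exact hr.2 j hj
  have hcardA : ∀ J, J.card = s → (A J).card = (d - 1) ^ (n - s) := by
    intro J hJ
    rw [Fintype.card_piFinset, ← Finset.prod_subset (Finset.subset_univ Jᶜ),
      Finset.prod_congr rfl fun j hj => by rw [if_neg (Finset.mem_compl.mp hj)],
      Finset.prod_const, Finset.card_compl, hJ, Fintype.card_fin, card_roots_derivative_T hd]
    intro j _ hj
    rw [if_pos (by simpa using hj), Finset.card_singleton]
  have hcardB : ∀ J r, J.card = s → r ∈ A J → (B J r).card = d ^ s := by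
    intro J r hJ hr
    have hz := (hZ J r hJ ((hA J r).mp hr).2).2.1
    rw [Fintype.card_piFinset, ← Finset.prod_subset (Finset.subset_univ J),
      Finset.prod_congr rfl fun j hj => by
        rw [if_pos hj, card_roots_T_sub_C hd (fun h => (hz j hj).1 (by linear_combination h))
          fun h => (hz j hj).2 (by linear_combination h)],
      Finset.prod_const, hJ]
    intro j _ hj
    rw [if_neg hj, Finset.card_singleton]
  have hcardS : S.card = n.choose s * d ^ s * (d - 1) ^ (n - s) := by
    rw [Finset.card_sigma, Finset.sum_congr rfl fun J hJ => by
      have hJ := (Finset.mem_powersetCard.mp hJ).2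
      rw [Finset.card_sigma, Finset.sum_congr rfl fun r hr => hcardB J r hJ hr, Finset.sum_const,
        hcardA J hJ]]
    rw [Finset.sum_const, Finset.card_powersetCard, Finset.card_univ, Fintype.card_fin]
    simp only [smul_eq_mul]
    ring
  have himage : ((S.image fun t => t.2.2 : Finset (Fin n → ℂ)) : Set (Fin n → ℂ)) =
      criticalPoints n d s := by
    ext x
    simp only [Finset.coe_image, Set.mem_image, Finset.mem_coe]
    constructor
    · rintro ⟨⟨J, r, x⟩, hS, rfl⟩
      simp only [S, Finset.mem_sigma, Finset.mem_powersetCard] at hS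
      obtain ⟨⟨-, hJ⟩, hr, hx⟩ := hS
      refine ⟨?_, by rw [hnc J r x hJ hr hx, hJ]⟩
      have hx' := (hB J r x).mp hx
      refine ((hZ J r hJ ((hA J r).mp hr).2).2.2 _ fun j hj => ?_).mpr fun j hj => ?_
      · rw [← hx'.2 j hj]
      · linear_combination hx'.1 j hj
    · rintro ⟨hf, hcard⟩
      let J := noncritical d x
      let r : Fin n → ℂ := fun j => if j ∈ J then 0 else x j
      have hr : r ∈ A J := by
        rw [hA]
        refine ⟨fun j hj => if_pos hj, fun j hj => ?_⟩
        have hrj : r j = x j := if_neg hj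
        rw [hrj]
        rwa [mem_noncritical, not_not] at hj
      refine ⟨⟨J, r, x⟩, ?_, rfl⟩
      simp only [S, Finset.mem_sigma, Finset.mem_powersetCard]
      refine ⟨⟨Finset.subset_univ _, hcard⟩, hr, ?_⟩
      have hrx : ∀ j ∉ J, x j = r j := fun j hj => (if_neg hj).symm
      rw [hB]
      refine ⟨fun j hj => ?_, hrx⟩
      have := ((hZ J r hcard ((hA J r).mp hr).2).2.2 _ fun j hj => by rw [hrx j hj]).mp hf j hj
      linear_combination this
  -- No point is counted twice: `x` determines `J` as its noncritical set, and then `r` as its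
  -- coordinates off `J`.
  have hinj : Set.InjOn (fun t : (Σ _ : Finset (Fin n), Σ _ : Fin n → ℂ, Fin n → ℂ) => t.2.2)
      S := by
    rintro ⟨J, r, x⟩ h ⟨J', r', x'⟩ h' hxx
    obtain rfl : x = x' := hxx
    simp only [S, Finset.mem_coe, Finset.mem_sigma, Finset.mem_powersetCard] at h h'
    obtain ⟨⟨-, hJ⟩, hr, hx⟩ := h
    obtain ⟨⟨-, hJ'⟩, hr', hx'⟩ := h'
    obtain rfl : J = J' := (hnc J r x hJ hr hx).symm.trans (hnc J' r' x hJ' hr' hx')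
    obtain rfl : r = r' := by
      ext j
      by_cases hj : j ∈ J
      · rw [((hA J r).mp hr).1 j hj, ((hA J r').mp hr').1 j hj]
      · rw [← ((hB J r x).mp hx).2 j hj, ((hB J r' x).mp hx').2 j hj]
    rfl
  rw [← himage]
  refine ⟨Finset.finite_toSet _, ?_⟩
  rw [Set.ncard_coe_finset, Finset.card_image_of_injOn hinj, hcardS]

end

end StartSystem

theorem mainTheorem5 (n d s : ℕ) (hs : s ≤ n) (hd : 2 ≤ d) :
    StartSystem.startVariety n d s ⊆ Set.univ ×ˢ StartSystem.chart s ∧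
    (StartSystem.startVariety n d s).Finite ∧
    (StartSystem.startVariety n d s).ncard = n.choose s * d ^ s * (d - 1) ^ (n - s) ∧
    Set.InjOn Prod.fst (StartSystem.startVariety n d s) ∧
    ∀ w ∈ StartSystem.startVariety n d s,
      MvPolynomial.aeval (Sum.elim w.1 (StartSystem.affineCoord w.2))
        (StartSystem.jacobianDet n d s) ≠ 0 := by
  have hd0 : d ≠ 0 := by omega
  have hinj := StartSystem.injOn_fst_startVariety (n := n) (s := s) hd0
  obtain ⟨hfin, hcard⟩ := StartSystem.finite_and_ncard_criticalPoints (n := n) (s := s) hd0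
  rw [← StartSystem.fst_image_startVariety hd0] at hfin hcard
  rw [hinj.ncard_image] at hcard
  exact ⟨fun w hw => ⟨Set.mem_univ _, StartSystem.rep_zero_ne_zero_of_mem hd0 hw⟩,
    hfin.of_finite_image hinj, hcard, hinj,
    fun w hw => StartSystem.aeval_jacobianDet_ne_zero_of_mem hd0 hw⟩
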